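/- (Plug-In Lemma.) Let $t\ge 1$ and $\ell\ge 0$ be integers, let $A_1,\dots,A_t$ be finite sets, and let $\vec y=(y_1,\dots,y_t)$ be a random vector with an arbitrary joint distribution $Y$ on $A_1\times\cdots\times A_t$. Let $\boldsymbol{s}$ be an $\ell$-qubit system that depends arbitrarily on $\vec y$: for every value of $\vec y$ there is an arbitrary density matrix $\rho_{\vec y}$ on $(\mathbb{C}^2)^{\otimes \ell}$, and $\boldsymbol{s}$ is prepared in the state $\rho_{\vec y}$. Let $j$ be uniform in $[t]=\{1,\dots,t\}$, independent of $(\vec y,\boldsymbol{s})$, and write $\vec y_{j-1}=(y_1,\dots,y_{j-1})$ for the prefix of $\vec y$ before position $j$ (the empty vector if $j=1$). Given $j$ and $\vec y$, let $y'$ be a fresh sample from the conditional distribution of the $j$-th coordinate of $Y$ given that its first $j-1$ coordinates equal $\vec y_{j-1}$; thus, given $j$ and $\vec y_{j-1}$, $y'$ is independent of $(\vec y,\boldsymbol{s})$. Then $$\mathrm{TD}\big((j,\vec y_{j-1},y_j,\boldsymbol{s}),\,(j,\vec y_{j-1},y',\boldsymbol{s})\big)\le\sqrt{\ell/(2t)},$$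 where each tuple is identified with its joint density matrix, i.e. $\mathbb{E}\big[|j,\vec y_{j-1},y_j\rangle\langle j,\vec y_{j-1},y_j|\otimes\rho_{\vec y}\big]$ and $\mathbb{E}\big[|j,\vec y_{j-1},y'\rangle\langle j,\vec y_{j-1},y'|\otimes\rho_{\vec y}\big]$ respectively, and $\mathrm{TD}(\rho,\sigma)=\tfrac12\|\rho-\sigma\|_1$ is the trace distance, with $\|A\|_1=\mathrm{tr}\sqrt{A^\dagger A}$. -/

import Mathlib

open scoped Kronecker ComplexOrder

/-- Density matrices on the finite-dimensional Hilbert space with orthonormal basis `d`: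
positive semidefinite complex matrices of trace one. -/
structure DensityMatrix (d : Type*) [Fintype d] where
  toMatrix : Matrix d d ℂ
  posSemidef : toMatrix.PosSemidef
  trace_eq_one : toMatrix.trace = 1

/-- Computational basis labels of an `ℓ`-qubit register (so the dimension is `2 ^ ℓ`). -/
abbrev Qubits (ℓ : ℕ) : Type := Fin ℓ → Fin 2

/-- The trace norm `‖A‖₁ = tr √(Aᴴ A)`, i.e. the sum of the singular values of `A`
(the square roots of the eigenvalues of `Aᴴ A`, with multiplicity). -/
noncomputable def traceNorm {d : Type*} [Fintype d] [DecidableEq d] (A : Matrix d d ℂ) : ℝ :=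
  ∑ i, √((Matrix.isHermitian_conjTranspose_mul_self A).eigenvalues i)

/-- The trace distance `TD(ρ, σ) = ½ ‖ρ - σ‖₁`. -/
noncomputable def traceDist {d : Type*} [Fintype d] [DecidableEq d]
    (ρ σ : DensityMatrix d) : ℝ :=
  (1 / 2 : ℝ) * traceNorm (ρ.toMatrix - σ.toMatrix)

theorem PMF.sum_toReal_eq_one {Ω : Type*} [Fintype Ω] (P : PMF Ω) :
    ∑ ω, (P ω).toReal = 1 := by
  rw [← ENNReal.toReal_sum (fun ω _ => P.apply_ne_top ω), ← tsum_fintype (L := .unconditional Ω),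
    P.tsum_coe, ENNReal.toReal_one]

/-- The joint state of a classical register and a quantum register.  An outcome `ω` is sampled
from `P`, the classical register is set to the value `c ω`, and the quantum register is prepared
in the state `s ω`; the joint density matrix is `∑ ω, P(ω) |c ω⟩⟨c ω| ⊗ s ω`. -/
noncomputable def cqState {Ω C d : Type*} [Fintype Ω] [Fintype C] [DecidableEq C] [Fintype d]
    (P : PMF Ω) (c : Ω → C) (s : Ω → DensityMatrix d) : DensityMatrix (C × d) where
  toMatrix := ∑ ω, (P ω).toReal • (Matrix.single (c ω) (c ω) (1 : ℂ) ⊗ₖ (s ω).toMatrix)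
  posSemidef := by
    refine Matrix.posSemidef_sum _ fun ω _ => ?_
    refine Matrix.PosSemidef.smul ?_ ENNReal.toReal_nonneg
    refine Matrix.PosSemidef.kronecker ?_ (s ω).posSemidef
    rw [← Matrix.diagonal_single]
    refine Matrix.PosSemidef.diagonal fun i => ?_
    by_cases h : i = c ω
    · subst h; simp
    · simp [h]
  trace_eq_one := by
    simp only [Matrix.trace_sum, Matrix.trace_smul, Matrix.trace_kronecker,
      Matrix.trace_single_eq_same, (s _).trace_eq_one, mul_one, Complex.real_smul]
    exact_mod_cast P.sum_toReal_eq_one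

/-- Values of the prefix of all entries strictly before position `j`. -/
abbrev PrefixValues {t : ℕ} (α : Fin t → Type*) (j : Fin t) : Type _ :=
  (i : {i : Fin t // i < j}) → α i

/-- The prefix of `y` consisting of all entries strictly before position `j`. -/
def prefixOf {t : ℕ} {α : Fin t → Type*} (j : Fin t) (y : ∀ i, α i) : PrefixValues α j :=
  fun i => y i

/-- The conditional distribution of the `j`-th entry of a sample of `Y`, given that the prefix
before `j` equals that of the possible outcome `y`. -/
noncomputable def condEntry {t : ℕ} {α : Fin t → Type*} (Y : PMF (∀ i, α i)) (j : Fin t)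
    (y : ∀ i, α i) (hy : y ∈ Y.support) : PMF (α j) :=
  (Y.filter {z | prefixOf j z = prefixOf j y} ⟨y, rfl, hy⟩).map fun z => z j

/-- The experiment that samples a uniform position `j`, then (independently of `j`) a sequence `y`
from `Y`, and then `y'` from the conditional distribution of the `j`-th entry given the prefix
of `y` before `j`.  The outcome is `⟨j, y, y'⟩`. -/
noncomputable def plugInExperiment {t : ℕ} [NeZero t] {α : Fin t → Type*}
    (Y : PMF (∀ i, α i)) : PMF (Σ j : Fin t, (∀ i, α i) × α j) :=
  (PMF.uniformOfFintype (Fin t)).bind fun j =>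
    Y.bindOnSupport fun y hy =>
      (condEntry Y j y hy).map fun y' => ⟨j, y, y'⟩

/-! This is an information-theoretic argument. Write ρ_k for the state of the register conditioned
on the first k entries. The left tuple carries the state conditioned on the prefix including y_j,
the right one only the state conditioned on the prefix before j. By quantum Pinsker their distance
is controlled by the relative entropy of ρ_{j+1} to ρ_j. Averaged over Y, this is a difference of
entropies, so the sum over j telescopes to at most log 2^ℓ ≤ ℓ, and the average over j is at most
ℓ/t.

The trace norm is tested against one contraction W (`exists_contraction_trace_mul_eq`). The
classical register is diagonal, so only diagonal blocks of W matter, and these are again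
contractions. Pinsker is used in the linearised form 2 Re tr W(A−B) ≤ κ + (2/κ) D(A‖B)
(`DensityMatrix.two_mul_re_trace_mul_sub_le`). It can therefore be averaged over j and y without
Jensen, and κ is chosen at the end. The chain rule is `sum_mul_negEntropy_sub_traceMulLog`. -/

/-! ### Scalar inequalities and Pinsker in coordinates. -/

/-- Pinsker-type refinement of `log x ≥ 1 - 1 / x`. -/
theorem pade_le_log {x : ℝ} (hx : 0 < x) :
    1 - x⁻¹ + 3 / 2 * (x - 1) ^ 2 / (x * (x + 2)) ≤ Real.log x := by
  set h : ℝ → ℝ := fun x => Real.log x - (1 - x⁻¹ + 3 / 2 * (x - 1) ^ 2 / (x * (x + 2))) with hh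
  -- The derivative has the sign of y − 1, so h has its minimum at 1, where it vanishes.
  have hder : ∀ y : ℝ, 0 < y → HasDerivAt h ((y - 1) ^ 3 / (y * (y + 2)) ^ 2) y := by
    intro y hy
    have h1 := (((hasDerivAt_id y).sub_const 1).pow 2).const_mul (3 / 2 : ℝ)
    have h2 := (hasDerivAt_id y).mul ((hasDerivAt_id y).add_const 2)
    have h3 := (Real.hasDerivAt_log hy.ne').sub
      (((hasDerivAt_inv hy.ne').const_sub 1).add (h1.div h2 (by simp; constructor <;> positivity)))
    refine h3.congr_deriv ?_
    simp
    field_simp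
    ring
  have hcont : ContinuousOn h (Set.Ioi 0) := fun y hy =>
    (hder y hy).continuousAt.continuousWithinAt
  have h1 : h 1 = 0 := by simp [hh]
  suffices 0 ≤ h x by simpa [hh] using this
  rw [← h1]
  rcases le_total x 1 with hx1 | hx1
  · have hanti : AntitoneOn h (Set.Icc x 1) := by
      refine antitoneOn_of_deriv_nonpos (convex_Icc _ _)
        (hcont.mono fun y hy => hx.trans_le hy.1) ?_ ?_ <;> intro y hy <;> rw [interior_Icc] at hy
      · exact (hder y (hx.trans hy.1)).differentiableAt.differentiableWithinAt
      · rw [(hder y (hx.trans hy.1)).deriv]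
        refine div_nonpos_of_nonpos_of_nonneg ?_ (by positivity)
        exact Odd.pow_nonpos (by decide) (by linarith [hy.2])
    exact hanti (by simp [hx1]) (by simp [hx1]) hx1
  · have hmono : MonotoneOn h (Set.Icc 1 x) := by
      refine monotoneOn_of_deriv_nonneg (convex_Icc _ _)
        (hcont.mono fun y hy => one_pos.trans_le hy.1) ?_ ?_ <;> intro y hy <;>
        rw [interior_Icc] at hy
      · exact (hder y (one_pos.trans hy.1)).differentiableAt.differentiableWithinAt
      · rw [(hder y (one_pos.trans hy.1)).deriv]
        exact div_nonneg (pow_nonneg (by linarith [hy.1]) 3) (by positivity)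
    exact hmono (by simp [hx1]) (by simp [hx1]) hx1

/-- This is `pade_le_log` at x = p/q, multiplied by 2p. The weights (p + 2q)/3 have total mass one
when p and q do, which gives Pinsker with its sharp constant. -/
theorem sq_sub_div_le_mul_log {p q : ℝ} (hp : 0 ≤ p) (hq : 0 < q) :
    (p - q) ^ 2 / ((p + 2 * q) / 3) ≤
      2 * (p * Real.log p - p * Real.log q - p + q) := by
  rcases hp.eq_or_lt with rfl | hp
  · have : (0 - q) ^ 2 / ((0 + 2 * q) / 3) = 3 / 2 * q := by field_simp; ring
    rw [this]; simp; linarith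
  · have h := mul_le_mul_of_nonneg_left (pade_le_log (div_pos hp hq)) (by positivity : 0 ≤ 2 * p)
    rw [Real.log_div hp.ne' hq.ne'] at h
    have : (p - q) ^ 2 / ((p + 2 * q) / 3) = 2 * p * (1 - (p / q)⁻¹ +
        3 / 2 * (p / q - 1) ^ 2 / (p / q * (p / q + 2))) - 2 * p + 2 * q := by
      field_simp; ring
    rw [this]; linarith

theorem two_mul_re_mul_le {z w : ℂ} {a : ℝ} (ha : 0 < a) :
    2 * (z * w).re ≤ a * ‖w‖ ^ 2 + ‖z‖ ^ 2 / a := by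
  have h1 : (z * w).re ≤ ‖z‖ * ‖w‖ := (Complex.re_le_norm _).trans (norm_mul z w).le
  have h2 : 0 ≤ (a * ‖w‖ - ‖z‖) ^ 2 / a := by positivity
  have h3 : (a * ‖w‖ - ‖z‖) ^ 2 / a = a * ‖w‖ ^ 2 + ‖z‖ ^ 2 / a - 2 * (‖z‖ * ‖w‖) := by
    field_simp; ring
  linarith

/-- Quantum Pinsker inequality in coordinates: `O` is the overlap matrix of two eigenbases and
`Z` is a test operator. -/
theorem pinsker_coordinates {n : Type*} [Fintype n] {O Z : n → n → ℂ} {p q : n → ℝ}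
    (hO₁ : ∀ i, ∑ j, ‖O i j‖ ^ 2 = 1) (hO₂ : ∀ j, ∑ i, ‖O i j‖ ^ 2 = 1)
    (hZ₁ : ∀ i, ∑ j, ‖Z j i‖ ^ 2 ≤ 1) (hZ₂ : ∀ j, ∑ i, ‖Z j i‖ ^ 2 ≤ 1)
    (hp : ∀ i, 0 ≤ p i) (hq : ∀ j, 0 ≤ q j) (hp₁ : ∑ i, p i = 1) (hq₁ : ∑ j, q j = 1)
    (hpq : ∀ i j, q j = 0 → ‖O i j‖ ^ 2 * p i = 0) {κ : ℝ} (hκ : 0 < κ) :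
    2 * ∑ i, ∑ j, ((p i - q j : ℝ) * O i j * Z j i).re ≤
      κ + 2 / κ * (∑ i, p i * Real.log (p i) -
        ∑ j, (∑ i, ‖O i j‖ ^ 2 * p i) * Real.log (q j)) := by
  have key : ∀ i j, 2 * ((p i - q j : ℝ) * O i j * Z j i).re ≤
      κ * (p i * ‖Z j i‖ ^ 2 / 3 + 2 * q j * ‖Z j i‖ ^ 2 / 3) + 2 / κ * (‖O i j‖ ^ 2 *
        (p i * Real.log (p i)) - ‖O i j‖ ^ 2 * p i * Real.log (q j) - ‖O i j‖ ^ 2 * p i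
          + ‖O i j‖ ^ 2 * q j) := by
    intro i j
    -- Since `Real.log 0 = 0`, the entropy inequality can fail at q j = 0; there `hpq` (absolute
    -- continuity) takes over.
    rcases (hq j).eq_or_lt with h0 | h0
    · have h1 := hpq i j h0.symm
      rw [← h0]
      rcases mul_eq_zero.1 h1 with h | h
      · have : O i j = 0 := by simpa using h
        simp only [this, mul_zero, zero_mul, Complex.zero_re, norm_zero]
        have := mul_nonneg hκ.le (mul_nonneg (hp i) (sq_nonneg ‖Z j i‖))
        simp
        linarith
      · simp [h]
    · have hw : 0 < (p i + 2 * q j) / 3 := by have := hp i; positivity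
      -- Weighted AM–GM with weight κ(p + 2q)/3: the ‖Z‖² part sums to at most κ, the rest is the
      -- divergence bound.
      have h1 := two_mul_re_mul_le (z := (p i - q j : ℝ) * O i j) (w := Z j i) (mul_pos hκ hw)
      refine h1.trans ?_
      have h2 : ‖((p i - q j : ℝ) : ℂ) * O i j‖ ^ 2 / (κ * ((p i + 2 * q j) / 3)) =
          1 / κ * ‖O i j‖ ^ 2 * ((p i - q j) ^ 2 / ((p i + 2 * q j) / 3)) := by
        rw [norm_mul, mul_pow, Complex.norm_real, Real.norm_eq_abs, sq_abs]
        field_simp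
      have h3 := mul_le_mul_of_nonneg_left (sq_sub_div_le_mul_log (hp i) h0)
        (by positivity : 0 ≤ 1 / κ * ‖O i j‖ ^ 2)
      rw [h2]
      refine (add_le_add_right h3 _).trans (le_of_eq ?_)
      ring
  have hsum := Finset.sum_le_sum fun i (_ : i ∈ Finset.univ) =>
    Finset.sum_le_sum fun j (_ : j ∈ Finset.univ) => key i j
  simp only [Finset.sum_add_distrib, ← Finset.mul_sum, Finset.sum_sub_distrib] at hsum
  have e1 : ∑ i, ∑ j, p i * ‖Z j i‖ ^ 2 / 3 ≤ 1 / 3 := by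
    calc _ ≤ ∑ i, p i / 3 := Finset.sum_le_sum fun i _ => by
          rw [← Finset.sum_div, ← Finset.mul_sum]
          have := mul_le_mul_of_nonneg_left (hZ₁ i) (hp i)
          linarith
      _ = 1 / 3 := by rw [← Finset.sum_div, hp₁]
  have e2 : ∑ i, ∑ j, 2 * q j * ‖Z j i‖ ^ 2 / 3 ≤ 2 / 3 := by
    rw [Finset.sum_comm]
    calc _ ≤ ∑ i, 2 * q i / 3 := Finset.sum_le_sum fun i _ => by
          rw [← Finset.sum_div, ← Finset.mul_sum]
          have := mul_le_mul_of_nonneg_left (hZ₂ i) (hq i)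
          linarith
      _ = 2 / 3 := by rw [← Finset.sum_div, ← Finset.mul_sum, hq₁]; ring
  have e3 : ∑ i, ∑ j, ‖O i j‖ ^ 2 * (p i * Real.log (p i)) = ∑ i, p i * Real.log (p i) := by
    simp [← Finset.sum_mul, hO₁]
  have e4 : ∑ i, ∑ j, ‖O i j‖ ^ 2 * p i * Real.log (q j) =
      ∑ j, (∑ i, ‖O i j‖ ^ 2 * p i) * Real.log (q j) := by
    rw [Finset.sum_comm]; simp [Finset.sum_mul]
  have e5 : ∑ i, ∑ j, ‖O i j‖ ^ 2 * p i = 1 := by simp [← Finset.sum_mul, hO₁, hp₁]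
  have e6 : ∑ i, ∑ j, ‖O i j‖ ^ 2 * q j = 1 := by
    rw [Finset.sum_comm]; simp [← Finset.sum_mul, hO₂, hq₁]
  rw [e3, e4, e5, e6] at hsum
  have := mul_le_mul_of_nonneg_left (add_le_add e1 e2) hκ.le
  linarith
-- Contractions and the trace norm.
open Matrix

section
variable {n : Type*} [Fintype n] [DecidableEq n]

theorem Matrix.IsHermitian.eigenvectorUnitary_spec {A : Matrix n n ℂ} (hA : A.IsHermitian) :
    (hA.eigenvectorUnitary : Matrix n n ℂ)ᴴ * (hA.eigenvectorUnitary : Matrix n n ℂ) = 1 ∧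
    (hA.eigenvectorUnitary : Matrix n n ℂ) * (hA.eigenvectorUnitary : Matrix n n ℂ)ᴴ = 1 ∧
    A = (hA.eigenvectorUnitary : Matrix n n ℂ) *
      diagonal (fun i => (hA.eigenvalues i : ℂ)) * (hA.eigenvectorUnitary : Matrix n n ℂ)ᴴ :=
  ⟨Unitary.coe_star_mul_self hA.eigenvectorUnitary,
    Unitary.coe_mul_star_self hA.eigenvectorUnitary, hA.spectral_theorem⟩

/-- With H = WᴴW, one has 1 − H = (1 − H)² + Wᴴ(1 − WWᴴ)W. -/
theorem posSemidef_one_sub_conjTranspose_mul_self {W : Matrix n n ℂ}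
    (hW : (1 - W * Wᴴ).PosSemidef) : (1 - Wᴴ * W).PosSemidef := by
  have h1 := posSemidef_conjTranspose_mul_self (1 - Wᴴ * W)
  have h2 := hW.conjTranspose_mul_mul_same W
  convert h1.add h2 using 1
  simp only [conjTranspose_sub, conjTranspose_one, conjTranspose_mul, conjTranspose_conjTranspose]
  noncomm_ring

/-- The trace norm is attained on a contraction. -/
theorem exists_contraction_trace_mul_eq (X : Matrix n n ℂ) :
    ∃ W : Matrix n n ℂ, (1 - W * Wᴴ).PosSemidef ∧ traceNorm X = (W * X).trace.re := by
  have hH := isHermitian_conjTranspose_mul_self X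
  have hnn := (posSemidef_conjTranspose_mul_self X).eigenvalues_nonneg
  obtain ⟨hU₁, hU₂, hU⟩ := hH.eigenvectorUnitary_spec
  unfold traceNorm
  set U : Matrix n n ℂ := (hH.eigenvectorUnitary : Matrix n n ℂ)
  set x := hH.eigenvalues
  -- UDUᴴ is the pseudo-inverse of |X| = √(XᴴX), since 0⁻¹ = 0. Thus W = |X|⁻¹Xᴴ satisfies WX = |X|,
  -- and WWᴴ is a projection.
  set D : Matrix n n ℂ := diagonal fun i => ((√(x i))⁻¹ : ℝ) with hD
  set E : Matrix n n ℂ := diagonal fun i => (x i : ℂ) with hE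
  have hDH : Dᴴ = D := by
    rw [hD, diagonal_conjTranspose]; congr 1; ext i; simp
  have hWX : U * D * Uᴴ * Xᴴ * X = U * (D * E) * Uᴴ := by
    calc _ = U * D * Uᴴ * (Xᴴ * X) := by simp only [Matrix.mul_assoc]
      _ = U * D * (Uᴴ * U) * E * Uᴴ := by rw [hU]; simp only [Matrix.mul_assoc]
      _ = _ := by rw [hU₁]; simp only [Matrix.mul_assoc, Matrix.one_mul]
  refine ⟨U * D * Uᴴ * Xᴴ, ?_, ?_⟩
  · have h1 : (U * D * Uᴴ * Xᴴ) * (U * D * Uᴴ * Xᴴ)ᴴ = U * (D * E * D) * Uᴴ := by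
      simp only [conjTranspose_mul, conjTranspose_conjTranspose, hDH]
      calc _ = (U * D * Uᴴ * Xᴴ * X) * (U * D * Uᴴ) := by simp only [Matrix.mul_assoc]
        _ = U * (D * E) * (Uᴴ * U) * D * Uᴴ := by rw [hWX]; simp only [Matrix.mul_assoc]
        _ = _ := by rw [hU₁]; simp only [Matrix.mul_assoc, Matrix.one_mul]
    have h2 : 1 - U * (D * E * D) * Uᴴ = U * (1 - D * E * D) * Uᴴ := by
      rw [Matrix.mul_sub, Matrix.sub_mul, Matrix.mul_one, hU₂]
    rw [h1, h2]
    refine PosSemidef.mul_mul_conjTranspose_same ?_ U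
    rw [hD, hE, diagonal_mul_diagonal, diagonal_mul_diagonal, ← diagonal_one, diagonal_sub]
    refine PosSemidef.diagonal fun i => ?_
    have : (√(x i))⁻¹ * x i * (√(x i))⁻¹ ≤ 1 := by
      rcases (hnn i).eq_or_lt with h | h
      · have h : x i = 0 := h.symm
        simp [h]
      · have h : 0 < x i := h
        have h3 : √(x i) ≠ 0 := (Real.sqrt_pos.2 h).ne'
        nth_rw 2 [← Real.mul_self_sqrt h.le]
        field_simp
        rfl
    have h4 : (0 : ℂ) ≤ ((1 - (√(x i))⁻¹ * x i * (√(x i))⁻¹ : ℝ) : ℂ) := by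
      exact_mod_cast sub_nonneg.2 this
    simpa using h4
  · rw [hWX, trace_mul_comm, ← Matrix.mul_assoc, hU₁, Matrix.one_mul, hD, hE,
      diagonal_mul_diagonal, trace_diagonal, Complex.re_sum]
    refine Finset.sum_congr rfl fun i _ => ?_
    rw [← Complex.ofReal_mul, Complex.ofReal_re, inv_mul_eq_div, Real.div_sqrt]

theorem sum_normSq_row_le {W : Matrix n n ℂ} (hW : (1 - W * Wᴴ).PosSemidef) (i : n) :
    ∑ j, ‖W i j‖ ^ 2 ≤ 1 := by
  have h := (Complex.le_def.1 (hW.diag_nonneg (i := i))).1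
  simp only [Matrix.sub_apply, one_apply_eq, mul_apply, conjTranspose_apply, Complex.zero_re,
    Complex.sub_re, Complex.one_re, Complex.re_sum, RCLike.star_def, Complex.mul_conj,
    Complex.ofReal_re, Complex.normSq_eq_norm_sq] at h
  linarith

theorem sum_normSq_row_eq {W : Matrix n n ℂ} (hW : W * Wᴴ = 1) (i : n) :
    ∑ j, ‖W i j‖ ^ 2 = 1 := by
  have h := congrArg Complex.re (congrFun (congrFun hW i) i)
  simpa only [one_apply_eq, mul_apply, conjTranspose_apply, Complex.one_re, Complex.re_sum,
    RCLike.star_def, Complex.mul_conj, Complex.ofReal_re, Complex.normSq_eq_norm_sq] using h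

/-- The defect of the block is the block of 1 − WWᴴ plus NNᴴ, where N collects the other blocks in
row c. -/
theorem posSemidef_one_sub_diagonal_block {C : Type*} [Fintype C] [DecidableEq C]
    {W : Matrix (C × n) (C × n) ℂ} (hW : (1 - W * Wᴴ).PosSemidef) (c : C) :
    (1 - W.submatrix (Prod.mk c) (Prod.mk c) *
      (W.submatrix (Prod.mk c) (Prod.mk c))ᴴ).PosSemidef := by
  set N : Matrix n (C × n) ℂ := Matrix.of fun i k => if k.1 = c then 0 else W (c, i) k with hN
  have h := (hW.submatrix (Prod.mk c)).add (posSemidef_self_mul_conjTranspose N)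
  convert h using 1
  ext i j
  have h1 : (1 : Matrix (C × n) (C × n) ℂ) (c, i) (c, j) = (1 : Matrix n n ℂ) i j := by
    simp [one_apply]
  simp only [Matrix.sub_apply, Matrix.add_apply, submatrix_apply, h1, mul_apply, conjTranspose_apply, hN,
    of_apply, Fintype.sum_prod_type]
  rw [sub_add, ← Finset.sum_sub_distrib]
  congr 1
  rw [Finset.sum_eq_single c]
  · simp
  · intro b _ hb
    simp [hb]
  · simp

/-! ### Entropy and the quantum Pinsker inequality. -/

theorem DensityMatrix.sum_eigenvalues (A : DensityMatrix n) :
    ∑ i, A.posSemidef.1.eigenvalues i = 1 := by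
  have h := A.posSemidef.1.trace_eq_sum_eigenvalues
  rw [A.trace_eq_one] at h
  have := congrArg Complex.re h
  simpa using this.symm

/-- The negative von Neumann entropy `tr (A log A)`. -/
noncomputable def DensityMatrix.negEntropy (A : DensityMatrix n) : ℝ :=
  ∑ i, A.posSemidef.1.eigenvalues i * Real.log (A.posSemidef.1.eigenvalues i)

theorem DensityMatrix.negEntropy_nonpos (A : DensityMatrix n) : A.negEntropy ≤ 0 := by
  refine Finset.sum_nonpos fun i _ => ?_
  have h0 := A.posSemidef.eigenvalues_nonneg i
  refine mul_nonpos_of_nonneg_of_nonpos h0 (Real.log_nonpos h0 ?_)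
  rw [← A.sum_eigenvalues]
  exact Finset.single_le_sum (fun j _ => A.posSemidef.eigenvalues_nonneg j) (Finset.mem_univ i)

/-- Gibbs' inequality against the uniform distribution: log x ≥ 1 − 1/x at x = card · λ, weighted by
the eigenvalue λ. -/
theorem DensityMatrix.neg_log_card_le_negEntropy (A : DensityMatrix n) :
    -Real.log (Fintype.card n) ≤ A.negEntropy := by
  have hcard : 0 < (Fintype.card n : ℝ) := by
    rcases isEmpty_or_nonempty n with h | h
    · have := A.sum_eigenvalues
      simp at this
    · exact_mod_cast Fintype.card_pos
  have key : ∀ i, A.posSemidef.1.eigenvalues i - (Fintype.card n : ℝ)⁻¹ -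
      A.posSemidef.1.eigenvalues i * Real.log (Fintype.card n) ≤
      A.posSemidef.1.eigenvalues i * Real.log (A.posSemidef.1.eigenvalues i) := by
    intro i
    rcases (A.posSemidef.eigenvalues_nonneg i).eq_or_lt with h | h
    · rw [← h]; simp
    · have h1 := Real.one_sub_inv_le_log_of_pos (mul_pos hcard h)
      rw [Real.log_mul hcard.ne' h.ne'] at h1
      have h2 := mul_le_mul_of_nonneg_left h1 h.le
      have h3 : A.posSemidef.1.eigenvalues i *
          (1 - ((Fintype.card n : ℝ) * A.posSemidef.1.eigenvalues i)⁻¹) =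
          A.posSemidef.1.eigenvalues i - (Fintype.card n : ℝ)⁻¹ := by
        field_simp
      linarith
  have hs := Finset.sum_le_sum fun i (_ : i ∈ Finset.univ) => key i
  rw [Finset.sum_sub_distrib, Finset.sum_sub_distrib, ← Finset.sum_mul, A.sum_eigenvalues] at hs
  simp only [Finset.sum_const, Finset.card_univ, nsmul_eq_mul, mul_inv_cancel₀ hcard.ne'] at hs
  unfold negEntropy
  linarith

/-- The real-linear functional `A ↦ tr (A log B)`. -/
noncomputable def DensityMatrix.traceMulLog (B : DensityMatrix n) (A : Matrix n n ℂ) : ℝ :=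
  ∑ j, ((((B.posSemidef.1.eigenvectorUnitary : Matrix n n ℂ)ᴴ * A *
    (B.posSemidef.1.eigenvectorUnitary : Matrix n n ℂ)) j j).re *
      Real.log (B.posSemidef.1.eigenvalues j))

theorem DensityMatrix.traceMulLog_self (B : DensityMatrix n) :
    B.traceMulLog B.toMatrix = B.negEntropy := by
  obtain ⟨hV₁, -, hV⟩ := B.posSemidef.1.eigenvectorUnitary_spec
  unfold traceMulLog negEntropy
  set V : Matrix n n ℂ := (B.posSemidef.1.eigenvectorUnitary : Matrix n n ℂ)
  have h : Vᴴ * B.toMatrix * V = diagonal fun i => (B.posSemidef.1.eigenvalues i : ℂ) := by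
    calc _ = Vᴴ * (V * diagonal (fun i => (B.posSemidef.1.eigenvalues i : ℂ)) * Vᴴ) * V := by
          rw [← hV]
      _ = (Vᴴ * V) * diagonal (fun i => (B.posSemidef.1.eigenvalues i : ℂ)) * (Vᴴ * V) := by
          simp only [Matrix.mul_assoc]
      _ = _ := by rw [hV₁, Matrix.one_mul, Matrix.mul_one]
  simp [h]

theorem DensityMatrix.traceMulLog_sum_smul (B : DensityMatrix n) {ι : Type*} (s : Finset ι)
    (c : ι → ℝ) (M : ι → Matrix n n ℂ) :
    B.traceMulLog (∑ i ∈ s, c i • M i) = ∑ i ∈ s, c i * B.traceMulLog (M i) := by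
  unfold traceMulLog
  simp only [Matrix.sum_apply, Complex.re_sum, Finset.mul_sum,
    Finset.sum_mul, Matrix.mul_smul, Matrix.smul_mul, Matrix.smul_apply, Complex.smul_re,
    smul_eq_mul]
  rw [Finset.sum_comm]
  simp only [mul_assoc]

/-- Quantum Pinsker inequality for explicitly diagonalised matrices, tested against a contraction
`W` and with the square root linearised by the parameter `κ`. -/
theorem two_mul_re_trace_mul_sub_le_of_spectral {A B U V W : Matrix n n ℂ} {p q : n → ℝ}
    (hU₁ : Uᴴ * U = 1) (hU₂ : U * Uᴴ = 1) (hU : A = U * diagonal (fun i => (p i : ℂ)) * Uᴴ)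
    (hV₁ : Vᴴ * V = 1) (hV₂ : V * Vᴴ = 1) (hV : B = V * diagonal (fun i => (q i : ℂ)) * Vᴴ)
    (hp : ∀ i, 0 ≤ p i) (hq : ∀ j, 0 ≤ q j) (hp₁ : ∑ i, p i = 1) (hq₁ : ∑ j, q j = 1)
    {c : ℝ} (hc : 0 < c) (hAB : (B - c • A).PosSemidef) (hW : (1 - W * Wᴴ).PosSemidef)
    {κ : ℝ} (hκ : 0 < κ) :
    2 * (W * (A - B)).trace.re ≤ κ + 2 / κ * (∑ i, p i * Real.log (p i) -
      ∑ j, ((Vᴴ * A * V) j j).re * Real.log (q j)) := by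
  set P : Matrix n n ℂ := diagonal fun i => (p i : ℂ) with hP
  set Q : Matrix n n ℂ := diagonal fun i => (q i : ℂ) with hQ
  set O : Matrix n n ℂ := Uᴴ * V with hO
  have hOH : Oᴴ = Vᴴ * U := by rw [hO, conjTranspose_mul, conjTranspose_conjTranspose]
  have hO₁ : O * Oᴴ = 1 := by
    rw [hOH, hO]
    calc _ = Uᴴ * (V * Vᴴ) * U := by simp only [Matrix.mul_assoc]
      _ = 1 := by rw [hV₂, Matrix.mul_one, hU₁]
  have hO₂ : Oᴴ * Oᴴᴴ = 1 := by
    rw [conjTranspose_conjTranspose, hOH, hO]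
    calc _ = Vᴴ * (U * Uᴴ) * V := by simp only [Matrix.mul_assoc]
      _ = 1 := by rw [hU₂, Matrix.mul_one, hV₁]
  set Z : Matrix n n ℂ := Vᴴ * W * U with hZ
  have hZ₂ : (1 - Z * Zᴴ).PosSemidef := by
    have h := hW.conjTranspose_mul_mul_same V
    convert h using 1
    rw [hZ, conjTranspose_mul, conjTranspose_mul, conjTranspose_conjTranspose, Matrix.mul_sub,
      Matrix.sub_mul, Matrix.mul_one, hV₁]
    congr 1
    calc _ = Vᴴ * W * (U * Uᴴ) * Wᴴ * V := by simp only [Matrix.mul_assoc]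
      _ = _ := by rw [hU₂]; simp only [Matrix.mul_assoc, Matrix.one_mul]
  have hZ₁ : (1 - Zᴴ * Zᴴᴴ).PosSemidef := by
    rw [conjTranspose_conjTranspose]; exact posSemidef_one_sub_conjTranspose_mul_self hZ₂
  have hVAV : Vᴴ * A * V = Oᴴ * P * O := by
    rw [hOH, hO, hU]; simp only [Matrix.mul_assoc]
  have hVBV : Vᴴ * B * V = Q := by
    calc _ = (Vᴴ * V) * Q * (Vᴴ * V) := by rw [hV]; simp only [Matrix.mul_assoc]
      _ = _ := by rw [hV₁, Matrix.one_mul, Matrix.mul_one]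
  have hdiag : ∀ j, ((Vᴴ * A * V) j j).re = ∑ i, ‖O i j‖ ^ 2 * p i := by
    intro j
    rw [hVAV, mul_apply, Complex.re_sum]
    refine Finset.sum_congr rfl fun i _ => ?_
    rw [hP, mul_diagonal, conjTranspose_apply, RCLike.star_def, mul_right_comm,
      Complex.conj_mul', ← Complex.ofReal_pow, ← Complex.ofReal_mul, Complex.ofReal_re]
  -- The j-th diagonal entry of Vᴴ(B − cA)V is q j − c ∑ ‖O i j‖² p i, which is nonnegative.
  have hpq : ∀ i j, q j = 0 → ‖O i j‖ ^ 2 * p i = 0 := by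
    intro i j hj
    have h := (Complex.le_def.1 ((hAB.conjTranspose_mul_mul_same V).diag_nonneg (i := j))).1
    rw [Matrix.mul_sub, Matrix.sub_mul, hVBV, Matrix.mul_smul, Matrix.smul_mul, Matrix.sub_apply,
      Matrix.smul_apply, Complex.sub_re, Complex.smul_re, hdiag, hQ, diagonal_apply_eq, hj] at h
    simp only [Complex.zero_re, Complex.ofReal_zero, zero_sub, smul_eq_mul] at h
    have hnn : ∀ i ∈ Finset.univ, 0 ≤ ‖O i j‖ ^ 2 * p i := fun i _ =>
      mul_nonneg (sq_nonneg _) (hp i)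
    have h0 : ∑ i, ‖O i j‖ ^ 2 * p i = 0 :=
      le_antisymm (nonpos_of_mul_nonpos_right (by linarith) hc) (Finset.sum_nonneg hnn)
    exact (Finset.sum_eq_zero_iff_of_nonneg hnn).1 h0 i (Finset.mem_univ i)
  have htr : (W * (A - B)).trace.re =
      ∑ i, ∑ j, ((p i - q j : ℝ) * O i j * Z j i).re := by
    -- Between the two eigenbases A − B has entries (p i − q j) O i j, although A and B need not
    -- commute.
    have h1 : A - B = U * (P * O - O * Q) * Vᴴ := by
      rw [Matrix.mul_sub, Matrix.sub_mul]
      congr 1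
      · calc _ = U * P * Uᴴ * (V * Vᴴ) := by rw [hV₂, Matrix.mul_one, ← hU]
          _ = _ := by rw [hO]; simp only [Matrix.mul_assoc]
      · calc _ = (U * Uᴴ) * (V * Q * Vᴴ) := by rw [hU₂, Matrix.one_mul, ← hV]
          _ = _ := by rw [hO]; simp only [Matrix.mul_assoc]
    have h2 : (W * (A - B)).trace = ((P * O - O * Q) * Z).trace := by
      calc _ = ((W * U) * ((P * O - O * Q) * Vᴴ)).trace := by
            rw [h1]; simp only [Matrix.mul_assoc]
        _ = _ := by rw [trace_mul_comm, hZ]; simp only [Matrix.mul_assoc]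
    rw [h2, trace, Complex.re_sum]
    refine Finset.sum_congr rfl fun i _ => ?_
    rw [diag_apply, mul_apply, Complex.re_sum]
    refine Finset.sum_congr rfl fun j _ => ?_
    rw [Matrix.sub_apply, hP, hQ, diagonal_mul, mul_diagonal]
    congr 2
    push_cast
    ring
  rw [htr]
  simp only [hdiag]
  refine pinsker_coordinates (sum_normSq_row_eq hO₁) (fun j => ?_) (fun i => ?_)
    (sum_normSq_row_le hZ₂) hp hq hp₁ hq₁ hpq hκ
  · simpa using sum_normSq_row_eq hO₂ j
  · simpa using sum_normSq_row_le hZ₁ i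

/-- Quantum Pinsker inequality, tested against a contraction `W` and with the square root
linearised by the parameter `κ`. -/
theorem DensityMatrix.two_mul_re_trace_mul_sub_le (A B : DensityMatrix n) {c : ℝ} (hc : 0 < c)
    (hAB : (B.toMatrix - c • A.toMatrix).PosSemidef) {W : Matrix n n ℂ}
    (hW : (1 - W * Wᴴ).PosSemidef) {κ : ℝ} (hκ : 0 < κ) :
    2 * (W * (A.toMatrix - B.toMatrix)).trace.re ≤
      κ + 2 / κ * (A.negEntropy - B.traceMulLog A.toMatrix) := by
  obtain ⟨hU₁, hU₂, hU⟩ := A.posSemidef.1.eigenvectorUnitary_spec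
  obtain ⟨hV₁, hV₂, hV⟩ := B.posSemidef.1.eigenvectorUnitary_spec
  exact two_mul_re_trace_mul_sub_le_of_spectral hU₁ hU₂ hU hV₁ hV₂ hV
    A.posSemidef.eigenvalues_nonneg B.posSemidef.eigenvalues_nonneg A.sum_eigenvalues
    B.sum_eigenvalues hc hAB hW hκ

end

/-! ### Expectations under `PMF` constructions. -/

section
variable {α β γ : Type*} [Fintype α] [Fintype β]

theorem PMF.sum_toReal_bind_mul (p : PMF α) (f : α → PMF β) (g : β → ℝ) :
    ∑ b, ((p.bind f) b).toReal * g b = ∑ a, (p a).toReal * ∑ b, (f a b).toReal * g b := by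
  simp only [PMF.bind_apply, tsum_fintype]
  simp_rw [ENNReal.toReal_sum fun a _ => ENNReal.mul_ne_top (p.apply_ne_top a)
    ((f a).apply_ne_top _), ENNReal.toReal_mul, Finset.sum_mul, Finset.mul_sum]
  rw [Finset.sum_comm]
  simp only [mul_assoc]

theorem PMF.sum_toReal_bindOnSupport_mul (p : PMF α) (f : ∀ a ∈ p.support, PMF β) (g : β → ℝ) :
    ∑ b, ((p.bindOnSupport f) b).toReal * g b =
      ∑ a, (p a).toReal * if h : p a = 0 then 0 else ∑ b, (f a h b).toReal * g b := by
  have hne : ∀ a b, (p a * if h : p a = 0 then 0 else f a h b) ≠ ⊤ := by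
    intro a b
    refine ENNReal.mul_ne_top (p.apply_ne_top a) ?_
    split_ifs with h
    · simp
    · exact (f a h).apply_ne_top b
  simp only [PMF.bindOnSupport_apply, tsum_fintype]
  simp_rw [ENNReal.toReal_sum fun a _ => hne a _, ENNReal.toReal_mul, Finset.sum_mul]
  rw [Finset.sum_comm]
  refine Finset.sum_congr rfl fun a _ => ?_
  split_ifs with h
  · simp
  · rw [Finset.mul_sum]
    simp only [mul_assoc]

theorem PMF.sum_toReal_map_mul (p : PMF α) (f : α → β) (g : β → ℝ) :
    ∑ b, ((p.map f) b).toReal * g b = ∑ a, (p a).toReal * g (f a) := by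
  classical
  rw [← PMF.bind_pure_comp, PMF.sum_toReal_bind_mul]
  refine Finset.sum_congr rfl fun a _ => ?_
  congr 1
  rw [Finset.sum_eq_single (f a)]
  · simp
  · intro b _ hb
    simp [PMF.pure_apply, hb]
  · simp

end

/-! ### Conditioning on prefixes. -/

section
variable {t : ℕ} {α : Fin t → Type*}

/-- Two sequences agree on their first `k` entries. -/
def PrefixAgree (k : ℕ) (y z : ∀ i, α i) : Prop := ∀ i : Fin t, i.val < k → y i = z i

theorem PrefixAgree.symm {k : ℕ} {y z : ∀ i, α i} (h : PrefixAgree k y z) : PrefixAgree k z y :=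
  fun i hi => (h i hi).symm

theorem PrefixAgree.trans {k : ℕ} {x y z : ∀ i, α i} (h : PrefixAgree k x y)
    (h' : PrefixAgree k y z) : PrefixAgree k x z :=
  fun i hi => (h i hi).trans (h' i hi)

theorem PrefixAgree.mono {k l : ℕ} (hkl : k ≤ l) {y z : ∀ i, α i} (h : PrefixAgree l y z) :
    PrefixAgree k y z :=
  fun i hi => h i (hi.trans_le hkl)

theorem PrefixAgree.left_eq {k : ℕ} {x y : ∀ i, α i} (h : PrefixAgree k x y) :
    PrefixAgree k x = PrefixAgree k y :=
  funext fun _ => propext ⟨fun h' => h.symm.trans h', fun h' => h.trans h'⟩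

theorem prefixOf_eq_iff (j : Fin t) (y z : ∀ i, α i) :
    prefixOf j z = prefixOf j y ↔ PrefixAgree j y z :=
  ⟨fun h i hi => (congrFun h ⟨i, hi⟩).symm, fun h => funext fun i => (h i.1 i.2).symm⟩

variable [∀ i, Fintype (α i)] (Y : PMF (∀ i, α i))

open Classical in
/-- The probability that the first `k` entries agree with those of `y`. -/
noncomputable def prefixProb (k : ℕ) (y : ∀ i, α i) : ℝ :=
  ∑ z, if PrefixAgree k y z then (Y z).toReal else 0

open Classical in
/-- The conditional probability of `z` given that the first `k` entries agree with those of `y`,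
with the point mass at `y` as value when the conditioning event is null. -/
noncomputable def condWeight (k : ℕ) (y z : ∀ i, α i) : ℝ :=
  if prefixProb Y k y = 0 then if z = y then 1 else 0
  else if PrefixAgree k y z then (Y z).toReal / prefixProb Y k y else 0

variable {Y}

theorem PrefixAgree.prefixProb_eq {k : ℕ} {y z : ∀ i, α i} (h : PrefixAgree k y z) :
    prefixProb Y k y = prefixProb Y k z := by
  unfold prefixProb
  rw [h.left_eq]

theorem prefixProb_nonneg (k : ℕ) (y : ∀ i, α i) : 0 ≤ prefixProb Y k y :=
  Finset.sum_nonneg fun z _ => by split_ifs <;> simp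

theorem toReal_le_prefixProb {k : ℕ} {y z : ∀ i, α i} (h : PrefixAgree k y z) :
    (Y z).toReal ≤ prefixProb Y k y := by
  classical
  have := Finset.single_le_sum (f := fun z => if PrefixAgree k y z then (Y z).toReal else 0)
    (fun i _ => by split_ifs <;> simp) (Finset.mem_univ z)
  simpa [h, prefixProb] using this

theorem prefixProb_pos {k : ℕ} {y z : ∀ i, α i} (h : PrefixAgree k y z) (hz : (Y z).toReal ≠ 0) :
    0 < prefixProb Y k y :=
  (lt_of_le_of_ne ENNReal.toReal_nonneg hz.symm).trans_le (toReal_le_prefixProb h)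

theorem condWeight_nonneg (k : ℕ) (y z : ∀ i, α i) : 0 ≤ condWeight Y k y z := by
  unfold condWeight
  have := prefixProb_nonneg (Y := Y) k y
  split_ifs <;> positivity

theorem sum_condWeight (k : ℕ) (y : ∀ i, α i) : ∑ z, condWeight Y k y z = 1 := by
  classical
  unfold condWeight
  by_cases h : prefixProb Y k y = 0
  · simp [h]
  · simp only [h, if_false]
    rw [← div_self h]
    nth_rw 2 [prefixProb]
    rw [Finset.sum_div]
    exact Finset.sum_congr rfl fun z _ => by split_ifs <;> simp

theorem prefixAgree_of_condWeight_ne_zero {k : ℕ} {y z : ∀ i, α i}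
    (h : condWeight Y k y z ≠ 0) : PrefixAgree k y z := by
  unfold condWeight at h
  split_ifs at h with h1 h2 h3
  · exact h2 ▸ fun _ _ => rfl
  · simp at h
  · exact h3
  · simp at h

/-- Detailed balance: when the prefixes agree and are not null, both sides are Y(y)Y(z) over the
common prefix probability. Hence y and its resample z are exchangeable. -/
theorem toReal_mul_condWeight_comm (k : ℕ) (y z : ∀ i, α i) :
    (Y y).toReal * condWeight Y k y z = (Y z).toReal * condWeight Y k z y := by
  by_cases h : PrefixAgree k y z
  · by_cases h0 : prefixProb Y k y = 0
    · have hz : (Y z).toReal = 0 := le_antisymm ((toReal_le_prefixProb h).trans h0.le) (by simp)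
      have hy : (Y y).toReal = 0 :=
        le_antisymm ((toReal_le_prefixProb fun _ _ => rfl).trans h0.le) (by simp)
      rw [hy, hz]; simp
    · simp only [condWeight, ← h.prefixProb_eq, h0, if_false, h, h.symm, if_true]
      ring
  · have h1 : condWeight Y k y z = 0 := not_imp_comm.1 prefixAgree_of_condWeight_ne_zero h
    have h2 : condWeight Y k z y = 0 :=
      not_imp_comm.1 prefixAgree_of_condWeight_ne_zero fun h' => h h'.symm
    rw [h1, h2]; simp

/-- Positive mass at z excludes the null default, a point mass that depends on more than the prefix.
-/
theorem PrefixAgree.condWeight_eq {k : ℕ} {y z : ∀ i, α i} (h : PrefixAgree k y z)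
    (hz : (Y z).toReal ≠ 0) (x : ∀ i, α i) : condWeight Y k y x = condWeight Y k z x := by
  have h0 := (prefixProb_pos h hz).ne'
  simp only [condWeight, ← h.prefixProb_eq, h0, if_false]
  rw [h.left_eq]

theorem sum_mul_sum_condWeight_swap (k : ℕ) (f : (∀ i, α i) → (∀ i, α i) → ℝ) :
    ∑ y, (Y y).toReal * ∑ z, condWeight Y k y z * f y z =
      ∑ y, (Y y).toReal * ∑ z, condWeight Y k y z * f z y := by
  simp only [Finset.mul_sum, ← mul_assoc]
  rw [Finset.sum_comm]
  exact Finset.sum_congr rfl fun y _ => Finset.sum_congr rfl fun z _ => by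
    rw [toReal_mul_condWeight_comm]

/-- Tower property of conditional expectation. -/
theorem sum_mul_sum_condWeight_mul (k : ℕ) (f : (∀ i, α i) → (∀ i, α i) → ℝ)
    (hf : ∀ y z, PrefixAgree k y z → (Y z).toReal ≠ 0 → f y z = f z z) :
    ∑ y, (Y y).toReal * ∑ z, condWeight Y k y z * f y z = ∑ y, (Y y).toReal * f y y := by
  rw [sum_mul_sum_condWeight_swap]
  refine Finset.sum_congr rfl fun y _ => ?_
  by_cases hy : (Y y).toReal = 0
  · simp [hy]
  congr 1
  rw [← one_mul (f y y), ← sum_condWeight (Y := Y) k y, Finset.sum_mul]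
  refine Finset.sum_congr rfl fun z _ => ?_
  by_cases hz : condWeight Y k y z = 0
  · simp [hz]
  · rw [hf z y (prefixAgree_of_condWeight_ne_zero hz).symm hy]

/-! ### Conditional states and the entropy chain rule. -/

variable {d : Type*} [Fintype d] (s : (∀ i, α i) → DensityMatrix d)

/-- The conditional state of the quantum register given the first `k` entries. -/
noncomputable def condState (Y : PMF (∀ i, α i)) (k : ℕ) (y : ∀ i, α i) : DensityMatrix d where
  toMatrix := ∑ z, condWeight Y k y z • (s z).toMatrix
  posSemidef := posSemidef_sum _ fun z _ => (s z).posSemidef.smul (condWeight_nonneg k y z)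
  trace_eq_one := by
    simp only [trace_sum, trace_smul, (s _).trace_eq_one, Complex.real_smul, mul_one]
    exact_mod_cast sum_condWeight k y

variable {s}

theorem PrefixAgree.condState_eq {k : ℕ} {y z : ∀ i, α i} (h : PrefixAgree k y z)
    (hz : (Y z).toReal ≠ 0) : condState s Y k y = condState s Y k z := by
  simp only [condState, h.condWeight_eq hz]

/-- The coarser state is a mixture containing the finer one with weight P(l-prefix)/P(k-prefix).
This supplies the absolute continuity for Pinsker. -/
theorem exists_posSemidef_condState_sub {k l : ℕ} (hkl : k ≤ l) {y : ∀ i, α i}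
    (hy : (Y y).toReal ≠ 0) : ∃ c : ℝ, 0 < c ∧
      ((condState s Y k y).toMatrix - c • (condState s Y l y).toMatrix).PosSemidef := by
  have hk := prefixProb_pos (k := k) (fun _ _ => rfl) hy
  have hl := prefixProb_pos (k := l) (fun _ _ => rfl) hy
  refine ⟨prefixProb Y l y / prefixProb Y k y, div_pos hl hk, ?_⟩
  simp only [condState, Finset.smul_sum, ← Finset.sum_sub_distrib, smul_smul, ← sub_smul]
  refine posSemidef_sum _ fun z _ => (s z).posSemidef.smul ?_
  simp only [condWeight, hk.ne', hl.ne', if_false]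
  by_cases h : PrefixAgree l y z
  · simp only [h, h.mono hkl, if_true]
    refine le_of_eq ?_
    field_simp
    ring
  · simp only [h, if_false, mul_zero, sub_zero]
    split_ifs <;> positivity

variable [DecidableEq d]

/-- Up to null sequences log ρ_k depends only on the k-prefix, so by linearity and the tower
property the cross term is the same for every l ≥ k. Taking l = k turns it into an entropy. -/
theorem sum_mul_traceMulLog_condState (k l : ℕ) (hkl : k ≤ l) :
    ∑ y, (Y y).toReal * (condState s Y k y).traceMulLog (condState s Y l y).toMatrix =
      ∑ y, (Y y).toReal * (condState s Y k y).traceMulLog (s y).toMatrix := by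
  have h := sum_mul_sum_condWeight_mul (Y := Y) l
    (fun y z => (condState s Y k y).traceMulLog (s z).toMatrix)
    fun y z h hz => by rw [(h.mono hkl).condState_eq hz]
  rw [← h]
  refine Finset.sum_congr rfl fun y _ => ?_
  rw [← DensityMatrix.traceMulLog_sum_smul]
  rfl

theorem sum_mul_negEntropy_sub_traceMulLog (k : ℕ) :
    ∑ y, (Y y).toReal * ((condState s Y (k + 1) y).negEntropy -
        (condState s Y k y).traceMulLog (condState s Y (k + 1) y).toMatrix) =
      ∑ y, (Y y).toReal * (condState s Y (k + 1) y).negEntropy -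
        ∑ y, (Y y).toReal * (condState s Y k y).negEntropy := by
  simp only [mul_sub, Finset.sum_sub_distrib]
  congr 1
  rw [sum_mul_traceMulLog_condState k (k + 1) (Nat.le_succ k),
    ← sum_mul_traceMulLog_condState k k le_rfl]
  simp only [DensityMatrix.traceMulLog_self]

/-- Chain rule together with the quantum Pinsker inequality. -/
theorem sum_two_mul_re_trace_mul_condState_sub_le (W : Fin t → (∀ i, α i) → Matrix d d ℂ)
    (hW : ∀ j y, (1 - W j y * (W j y)ᴴ).PosSemidef) {κ : ℝ} (hκ : 0 < κ) :
    ∑ j : Fin t, ∑ y, (Y y).toReal * (2 * (W j y * ((condState s Y (j + 1) y).toMatrix -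
        (condState s Y j y).toMatrix)).trace.re) ≤
      t * κ + 2 / κ * Real.log (Fintype.card d) := by
  set Φ : ℕ → ℝ := fun k => ∑ y, (Y y).toReal * (condState s Y k y).negEntropy with hΦ
  have key : ∀ j : Fin t, ∑ y, (Y y).toReal * (2 * (W j y * ((condState s Y (j + 1) y).toMatrix -
      (condState s Y j y).toMatrix)).trace.re) ≤ κ + 2 / κ * (Φ (j + 1) - Φ j) := by
    intro j
    have hκ₁ : κ = ∑ y, (Y y).toReal * κ := by
      rw [← Finset.sum_mul, Y.sum_toReal_eq_one, one_mul]
    rw [hΦ, ← sum_mul_negEntropy_sub_traceMulLog, Finset.mul_sum]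
    nth_rw 1 [hκ₁]
    rw [← Finset.sum_add_distrib]
    refine Finset.sum_le_sum fun y _ => ?_
    by_cases hy : (Y y).toReal = 0
    · simp [hy]
    obtain ⟨c, hc, hc'⟩ := exists_posSemidef_condState_sub (s := s) (Nat.le_succ j) hy
    have h := mul_le_mul_of_nonneg_left (DensityMatrix.two_mul_re_trace_mul_sub_le _ _ hc hc'
      (hW j y) hκ) (ENNReal.toReal_nonneg (a := Y y))
    refine h.trans (le_of_eq ?_)
    simp only [Nat.succ_eq_add_one]
    ring
  have hlast : Φ t ≤ 0 := Finset.sum_nonpos fun y _ =>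
    mul_nonpos_of_nonneg_of_nonpos ENNReal.toReal_nonneg (DensityMatrix.negEntropy_nonpos _)
  have hfirst : -Real.log (Fintype.card d) ≤ Φ 0 := by
    calc _ = ∑ y, (Y y).toReal * -Real.log (Fintype.card d) := by
          rw [← Finset.sum_mul, Y.sum_toReal_eq_one, one_mul]
      _ ≤ _ := Finset.sum_le_sum fun y _ => mul_le_mul_of_nonneg_left
          (DensityMatrix.neg_log_card_le_negEntropy _) ENNReal.toReal_nonneg
  refine (Finset.sum_le_sum fun j _ => key j).trans ?_
  -- The sum telescopes to Φ t − Φ 0, at most the log of the dimension.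
  rw [Finset.sum_add_distrib, ← Finset.mul_sum, Fin.sum_univ_eq_sum_range
    (fun j => Φ (j + 1) - Φ j), Finset.sum_range_sub]
  simp only [Finset.sum_const, Finset.card_univ, Fintype.card_fin, nsmul_eq_mul]
  have : 2 / κ * (Φ t - Φ 0) ≤ 2 / κ * Real.log (Fintype.card d) :=
    mul_le_mul_of_nonneg_left (by linarith) (by positivity)
  linarith

/-- The fresh y' is realised as the j-th entry of a full resample z, which makes exchangeability of
y and z available. -/
theorem sum_plugInExperiment_mul [NeZero t] (g : (Σ j : Fin t, (∀ i, α i) × α j) → ℝ) :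
    ∑ ω, (plugInExperiment Y ω).toReal * g ω =
      ∑ j : Fin t, (t : ℝ)⁻¹ * ∑ y, (Y y).toReal *
        ∑ z, condWeight Y j y z * g ⟨j, y, z j⟩ := by
  classical
  unfold plugInExperiment
  rw [PMF.sum_toReal_bind_mul]
  refine Finset.sum_congr rfl fun j _ => ?_
  congr 1
  · simp
  rw [PMF.sum_toReal_bindOnSupport_mul]
  refine Finset.sum_congr rfl fun y _ => ?_
  by_cases hy : Y y = 0
  · simp [hy]
  rw [dif_neg hy]
  congr 1
  rw [PMF.sum_toReal_map_mul]
  unfold condEntry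
  rw [PMF.sum_toReal_map_mul]
  refine Finset.sum_congr rfl fun z _ => ?_
  congr 1
  have hy' : (Y y).toReal ≠ 0 := ENNReal.toReal_ne_zero.2 ⟨hy, Y.apply_ne_top y⟩
  have h0 := prefixProb_pos (k := j) (fun _ _ => rfl) hy'
  rw [PMF.filter_apply, tsum_fintype, ENNReal.toReal_mul, ENNReal.toReal_inv, ENNReal.toReal_sum]
  · simp only [condWeight, h0.ne', if_false, Set.indicator_apply, Set.mem_ofPred_eq,
      prefixOf_eq_iff, apply_ite ENNReal.toReal, ENNReal.toReal_zero]
    rw [← prefixProb]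
    split_ifs <;> simp [div_eq_mul_inv]
  · intro z _
    rw [Set.indicator_apply]
    split_ifs
    · exact Y.apply_ne_top z
    · simp

end

/-! ### Assembling the bound. -/

theorem re_trace_mul_cqState {Ω C d : Type*} [Fintype Ω] [Fintype C] [DecidableEq C] [Fintype d]
    (P : PMF Ω) (c : Ω → C) (s : Ω → DensityMatrix d) (W : Matrix (C × d) (C × d) ℂ) :
    (W * (cqState P c s).toMatrix).trace.re = ∑ ω, (P ω).toReal *
      (W.submatrix (Prod.mk (c ω)) (Prod.mk (c ω)) * (s ω).toMatrix).trace.re := by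
  simp only [cqState, Matrix.mul_sum, trace_sum, Complex.re_sum, Matrix.mul_smul, trace_smul,
    Complex.smul_re, smul_eq_mul]
  refine Finset.sum_congr rfl fun ω _ => ?_
  congr 2
  simp only [trace, diag_apply, mul_apply, Fintype.sum_prod_type, kronecker_apply, single_apply,
    submatrix_apply]
  rw [Finset.sum_eq_single (c ω)]
  · refine Finset.sum_congr rfl fun i _ => ?_
    rw [Finset.sum_eq_single (c ω)]
    · simp
    · intro b _ hb
      simp [hb.symm]
    · simp
  · intro b _ hb
    simp [hb.symm]
  · simp

theorem mainTheorem5 {t : ℕ} [NeZero t] (ℓ : ℕ)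
    (α : Fin t → Type*) [∀ i, Fintype (α i)] [∀ i, DecidableEq (α i)]
    (Y : PMF (∀ i, α i)) (s : (∀ i, α i) → DensityMatrix (Qubits ℓ)) :
    traceDist
        (cqState (C := Σ j : Fin t, PrefixValues α j × α j) (plugInExperiment Y)
          (fun ω => ⟨ω.1, prefixOf ω.1 ω.2.1, ω.2.1 ω.1⟩) (fun ω => s ω.2.1))
        (cqState (C := Σ j : Fin t, PrefixValues α j × α j) (plugInExperiment Y)
          (fun ω => ⟨ω.1, prefixOf ω.1 ω.2.1, ω.2.2⟩) (fun ω => s ω.2.1))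
      ≤ √((ℓ : ℝ) / (2 * (t : ℝ))) := by
  have ht : (0 : ℝ) < t := by exact_mod_cast Nat.pos_of_ne_zero (NeZero.ne t)
  unfold traceDist
  set R₁ := cqState (C := Σ j : Fin t, PrefixValues α j × α j) (plugInExperiment Y)
    (fun ω => ⟨ω.1, prefixOf ω.1 ω.2.1, ω.2.1 ω.1⟩) (fun ω => s ω.2.1) with hR₁
  set R₂ := cqState (C := Σ j : Fin t, PrefixValues α j × α j) (plugInExperiment Y)
    (fun ω => ⟨ω.1, prefixOf ω.1 ω.2.1, ω.2.2⟩) (fun ω => s ω.2.1) with hR₂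
  obtain ⟨W, hW, hWX⟩ := exists_contraction_trace_mul_eq (R₁.toMatrix - R₂.toMatrix)
  set c : Fin t → (∀ i, α i) → Σ j : Fin t, PrefixValues α j × α j :=
    fun j y => ⟨j, prefixOf j y, y j⟩ with hc
  set V : Fin t → (∀ i, α i) → Matrix (Qubits ℓ) (Qubits ℓ) ℂ :=
    fun j y => W.submatrix (Prod.mk (c j y)) (Prod.mk (c j y)) with hV
  have hlin : ∀ (j : Fin t) (k : ℕ) (y : ∀ i, α i),
      (V j y * (condState s Y k y).toMatrix).trace.re =
        ∑ z, condWeight Y k y z * (V j y * (s z).toMatrix).trace.re := by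
    intro j k y
    simp only [condState, Matrix.mul_sum, trace_sum, Complex.re_sum, Matrix.mul_smul, trace_smul,
      Complex.smul_re, smul_eq_mul]
  have hVcongr : ∀ (j : Fin t) (y z : ∀ i, α i), PrefixAgree (j + 1) y z → V j y = V j z := by
    intro j y z h
    have h1 : prefixOf j y = prefixOf j z :=
      (prefixOf_eq_iff j z y).2 (h.mono (Nat.le_succ _)).symm
    have h2 : y j = z j := h j (Nat.lt_succ_self _)
    simp only [hV, hc, h1, h2]
  have h₁ : (W * R₁.toMatrix).trace.re = (t : ℝ)⁻¹ * ∑ j : Fin t, ∑ y, (Y y).toReal *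
      (V j y * (condState s Y (j + 1) y).toMatrix).trace.re := by
    rw [hR₁, re_trace_mul_cqState, sum_plugInExperiment_mul (Y := Y) (fun ω =>
      (V ω.1 ω.2.1 * (s ω.2.1).toMatrix).trace.re), ← Finset.mul_sum]
    congr 1
    refine Finset.sum_congr rfl fun j _ => ?_
    simp only [hlin, ← Finset.sum_mul, sum_condWeight, one_mul]
    -- The block V j y sees exactly the entries up to and including j, so the state may be averaged
    -- given the first j + 1 entries.
    exact (sum_mul_sum_condWeight_mul _ (fun y z => (V j y * (s z).toMatrix).trace.re)
      fun y z h _ => by rw [hVcongr j y z h]).symm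
  have h₂ : (W * R₂.toMatrix).trace.re = (t : ℝ)⁻¹ * ∑ j : Fin t, ∑ y, (Y y).toReal *
      (V j y * (condState s Y j y).toMatrix).trace.re := by
    rw [hR₂, re_trace_mul_cqState, sum_plugInExperiment_mul (Y := Y) (fun ω =>
      (W.submatrix (Prod.mk ⟨ω.1, prefixOf ω.1 ω.2.1, ω.2.2⟩)
        (Prod.mk ⟨ω.1, prefixOf ω.1 ω.2.1, ω.2.2⟩) * (s ω.2.1).toMatrix).trace.re),
      ← Finset.mul_sum]
    congr 1
    refine Finset.sum_congr rfl fun j _ => ?_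
    simp only [hlin]
    -- Exchanging y with its resample z makes the classical label that of one sequence and the state
    -- that of the other; they share only the prefix before j, hence ρ_j.
    rw [← sum_mul_sum_condWeight_swap j (fun z y => (V j y * (s z).toMatrix).trace.re)]
    refine Finset.sum_congr rfl fun y _ => ?_
    congr 1
    refine Finset.sum_congr rfl fun z _ => ?_
    by_cases h : condWeight Y j y z = 0
    · simp [h]
    · have h1 : prefixOf j z = prefixOf j y :=
        (prefixOf_eq_iff j y z).2 (prefixAgree_of_condWeight_ne_zero h)
      simp only [hV, hc, h1]
  have hlog : Real.log (Fintype.card (Qubits ℓ)) ≤ ℓ := by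
    rw [Fintype.card_fun, Fintype.card_fin, Fintype.card_fin, Nat.cast_pow, Real.log_pow]
    have h2 : Real.log ((2 : ℕ) : ℝ) ≤ 1 := by
      have := Real.log_two_lt_d9
      push_cast
      linarith
    exact mul_le_of_le_one_right (Nat.cast_nonneg ℓ) h2
  have hbound : ∀ κ : ℝ, 0 < κ →
      1 / 2 * traceNorm (R₁.toMatrix - R₂.toMatrix) ≤ κ / 4 + ℓ / (2 * t) / κ := by
    intro κ hκ
    have h := sum_two_mul_re_trace_mul_condState_sub_le (Y := Y) (s := s) V
      (fun j y => posSemidef_one_sub_diagonal_block hW (c j y)) hκ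
    simp only [trace_sub, Complex.sub_re, mul_sub, Finset.sum_sub_distrib,
      mul_left_comm _ (2 : ℝ), ← Finset.mul_sum] at h
    rw [hWX, Matrix.mul_sub, trace_sub, Complex.sub_re, h₁, h₂]
    have h3 : 2 / κ * Real.log (Fintype.card (Qubits ℓ)) ≤ 2 / κ * ℓ :=
      mul_le_mul_of_nonneg_left hlog (by positivity)
    have h4 := mul_le_mul_of_nonneg_left (h.trans (add_le_add_right h3 _))
      (by positivity : 0 ≤ (t : ℝ)⁻¹ / 4)
    have h5 : (t : ℝ)⁻¹ / 4 * (t * κ + 2 / κ * ℓ) = κ / 4 + ℓ / (2 * t) / κ := by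
      field_simp
      ring
    rw [h5] at h4
    refine le_trans (le_of_eq ?_) h4
    ring
  -- The optimum is κ = 2√(ℓ/(2t)); for ℓ = 0 this is not positive, so κ tends to 0 instead.
  rcases Nat.eq_zero_or_pos ℓ with rfl | hℓ
  · simp only [Nat.cast_zero, zero_div, Real.sqrt_zero, add_zero] at hbound ⊢
    refine le_of_forall_pos_le_add fun ε hε => ?_
    have := hbound (4 * ε) (by positivity)
    linarith
  · set x : ℝ := √((ℓ : ℝ) / (2 * t)) with hx
    have hx0 : 0 < x := Real.sqrt_pos.2 (by positivity)
    have hxx : (ℓ : ℝ) / (2 * t) = x * x := (Real.mul_self_sqrt (by positivity)).symm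
    have h := hbound (2 * x) (by positivity)
    rw [hxx] at h
    refine h.trans (le_of_eq ?_)
    field_simp
    ring
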